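/- Let $X$ be a two-dimensional real Banach space. For a compact Hausdorff space $K$, let $C(K)$ be the Banach space of continuous real-valued functions on $K$ with the maximum norm. A linear isometry (into) $T\colon X\to C(K)$ is called a U-embedding if every $x^*\in X^*$ with $\|x^*\|=1$ has a unique Hahn--Banach extension through $T$, that is, if there is exactly one $y^*\in C(K)^*$ with $y^*\circ T=x^*$ and $\|y^*\|=\|x^*\|$. Then there exist a compact Hausdorff space $K$ and a U-embedding $T\colon X\to C(K)$ if and only if $X$ is not Gâteaux smooth, i.e. if and only if the norm of $X$ fails to be Gâteaux differentiable at some nonzero point of $X$. -/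

import Mathlib

universe u v

/-- For a linear isometry `T : X → Y` (into), `g ∈ Y*` is a Hahn--Banach extension of `f ∈ X*`
through `T` if `T* g = f` (that is, `g ∘ T = f`) and `‖g‖ = ‖f‖`. -/
def IsHahnBanachExtension {X Y : Type*} [NormedAddCommGroup X] [NormedSpace ℝ X]
    [NormedAddCommGroup Y] [NormedSpace ℝ Y] (T : X →ₗᵢ[ℝ] Y)
    (f : StrongDual ℝ X) (g : StrongDual ℝ Y) : Prop :=
  g.comp T.toContinuousLinearMap = f ∧ ‖g‖ = ‖f‖

/-- A linear isometry `T : X → Y` (into) is a U-embedding if every norm-one functional on `X`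
has exactly one Hahn--Banach extension through `T`. -/
def IsUEmbedding {X Y : Type*} [NormedAddCommGroup X] [NormedSpace ℝ X]
    [NormedAddCommGroup Y] [NormedSpace ℝ Y] (T : X →ₗᵢ[ℝ] Y) : Prop :=
  ∀ f : StrongDual ℝ X, ‖f‖ = 1 → ∃! g : StrongDual ℝ Y, IsHahnBanachExtension T f g

/-- A real function `φ` on a normed space is Gâteaux differentiable at `x` if there is a continuous
linear functional whose value at each `v` is the (two-sided) derivative of `φ` at `x` in the
direction `v`. -/
def GateauxDifferentiableAt {X : Type*} [NormedAddCommGroup X] [NormedSpace ℝ X]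
    (φ : X → ℝ) (x : X) : Prop :=
  ∃ L : StrongDual ℝ X, ∀ v : X, HasLineDerivAt ℝ φ (L v) x v

/-- A normed space is Gâteaux smooth if its norm is Gâteaux differentiable at every nonzero
point. -/
def IsGateauxSmooth (X : Type*) [NormedAddCommGroup X] [NormedSpace ℝ X] : Prop :=
  ∀ x : X, x ≠ 0 → GateauxDifferentiableAt (fun y : X => ‖y‖) x

/-! Suppose `X` is smooth and `T` is a U-embedding. A norm-one `f` attains its norm at some `x`, and
`|T x|` peaks at some `k`; smoothness at `x` forces `f` to be plus or minus evaluation at `k`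
composed with `T`. So the dual sphere is `A ∪ -A`, with `A` the closed set of functionals induced by
points of `K`. The sphere of a plane is connected, so some `f` lies in both parts and has two
extensions, `δ_k` and `-δ_l`, which differ at the constant `1`.

Conversely, a point of non-smoothness gives a segment in the dual sphere. The line through the
origin and its midpoint misses every extreme point of the dual ball, so it selects one from each
pair `±e`. The selected points form a compact `K` (`isClosed_extremeSphere`, special to the plane),
and evaluation embeds `X` isometrically in `C(K)`. An extension of a functional attaining its norm
at `x` sees only the set where `|T x| = 1` (`apply_eq_zero_of_eqOn_peak`). That set has at most two
points, where `T` interpolates all values, so the extension is determined. -/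

open Metric Set Filter Topology

/-! ### Norm-preserving extensions and norm attainment -/

section HahnBanach

variable {X Y : Type*} [NormedAddCommGroup X] [NormedSpace ℝ X]
  [NormedAddCommGroup Y] [NormedSpace ℝ Y]

/-- Hahn--Banach extensions through an isometry exist. -/
theorem exists_isHahnBanachExtension (T : X →ₗᵢ[ℝ] Y) (f : StrongDual ℝ X) :
    ∃ g : StrongDual ℝ Y, IsHahnBanachExtension T f g := by
  let e := T.equivRange
  obtain ⟨g, hg, hn⟩ := exists_extension_norm_eq (𝕜 := ℝ) T.range
    (f.comp (e.symm.toContinuousLinearEquiv : T.range →L[ℝ] X))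
  have hgT : g.comp T.toContinuousLinearMap = f := by
    ext x
    have := hg (e x)
    simpa [e] using this
  refine ⟨g, hgT, le_antisymm ?_ ?_⟩
  · rw [hn]
    refine ContinuousLinearMap.opNorm_le_bound _ (norm_nonneg _) fun x => ?_
    have := f.le_opNorm (e.symm x)
    simpa [e.symm.norm_map] using this
  · rw [← hgT]
    refine ContinuousLinearMap.opNorm_le_bound _ (norm_nonneg _) fun x => ?_
    have := g.le_opNorm (T x)
    simpa [T.norm_map] using this

/-- A functional on a finite-dimensional space attains its norm on the unit sphere. -/
theorem exists_norm_eq_one_apply_eq_one [FiniteDimensional ℝ X] (f : StrongDual ℝ X)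
    (hf : ‖f‖ = 1) : ∃ x : X, ‖x‖ = 1 ∧ f x = 1 := by
  obtain ⟨x, hx, hmax⟩ := (isCompact_closedBall (0 : X) 1).exists_isMaxOn
    ⟨0, by simp⟩ f.continuous.continuousOn
  have hx1 : ‖x‖ ≤ 1 := by simpa using hx
  have h0 : 0 ≤ f x := by simpa using hmax (show (0 : X) ∈ closedBall 0 1 by simp)
  have hle : ‖f‖ ≤ f x := by
    refine ContinuousLinearMap.opNorm_le_of_unit_norm h0 fun z hz => ?_
    rw [Real.norm_eq_abs, abs_le]
    have h1 : f z ≤ f x := hmax (show z ∈ closedBall (0 : X) 1 by simp [hz])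
    have h2 : f (-z) ≤ f x := hmax (show -z ∈ closedBall (0 : X) 1 by simp [hz])
    rw [map_neg] at h2
    constructor <;> linarith
  have hfx : f x ≤ ‖x‖ := by
    have := (le_abs_self _).trans (f.le_opNorm x)
    rwa [hf, one_mul] at this
  exact ⟨x, by linarith, by linarith⟩

theorem apply_le_of_norm_le_one {f : StrongDual ℝ X} (hf : ‖f‖ ≤ 1) (x : X) : f x ≤ ‖x‖ :=
  (le_abs_self _).trans ((f.le_opNorm x).trans (by nlinarith [norm_nonneg x]))

end HahnBanach

/-! ### Smoothness, support functionals and the connectedness obstruction -/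

section Smooth

variable {X : Type*} [NormedAddCommGroup X] [NormedSpace ℝ X]

/-- A supporting functional at a point of Gâteaux differentiability is the derivative. -/
theorem support_eq_of_hasLineDerivAt {x : X} {L f : StrongDual ℝ X}
    (hL : ∀ v : X, HasLineDerivAt ℝ (fun y : X => ‖y‖) (L v) x v)
    (hf : ‖f‖ ≤ 1) (hfx : f x = ‖x‖) : f = L := by
  ext v
  have h : HasDerivAt (fun t : ℝ => ‖x + t • v‖ - f (x + t • v)) (L v - f v) 0 := by
    have h1 : HasDerivAt (fun t : ℝ => ‖x + t • v‖) (L v) 0 := hL v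
    have h2 : HasDerivAt (fun t : ℝ => f (x + t • v)) (f v) 0 := by
      simpa using ((hasDerivAt_id (0 : ℝ)).mul_const (f v)).const_add (f x)
    exact h1.sub h2
  have hmin : IsLocalMin (fun t : ℝ => ‖x + t • v‖ - f (x + t • v)) 0 :=
    Eventually.of_forall fun t => by
      have := apply_le_of_norm_le_one hf (x + t • v)
      simp only [zero_smul, add_zero, hfx, sub_self]
      linarith
  have := hmin.hasDerivAt_eq_zero h
  linarith

/-- In finite dimension the norm is Gâteaux differentiable where the support functional is
unique. -/
theorem gateauxDifferentiableAt_of_unique_support [FiniteDimensional ℝ X] [Nontrivial X] {x : X}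
    (hu : ∀ f g : StrongDual ℝ X, ‖f‖ = 1 → ‖g‖ = 1 → f x = ‖x‖ → g x = ‖x‖ → f = g) : GateauxDifferentiableAt (fun y : X => ‖y‖) x := by
  obtain ⟨f, hf, hfx⟩ := exists_dual_vector' ℝ x
  simp only [RCLike.ofReal_real_eq_id, id] at hfx
  refine ⟨f, fun v => ?_⟩
  choose F hF hFx using fun y : X => exists_dual_vector' ℝ y
  simp only [RCLike.ofReal_real_eq_id, id] at hFx
  have hcont : Tendsto (fun t : ℝ => x + t • v) (𝓝 0) (𝓝 x) := by
    have : Continuous fun t : ℝ => x + t • v := by fun_prop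
    simpa using this.tendsto 0
  -- Every cluster point of the chosen supports has norm one and supports at `x`, hence is `f`;
  -- compactness of the sphere turns this into convergence.
  have hlim : Tendsto (fun t : ℝ => F (x + t • v)) (𝓝 0) (𝓝 f) := by
    refine (isCompact_sphere (0 : StrongDual ℝ X) 1).tendsto_nhds_of_unique_mapClusterPt
      (Eventually.of_forall fun t => by simp [hF]) fun g hg hc => ?_
    obtain ⟨U, hU, hUg⟩ := mapClusterPt_iff_ultrafilter.1 hc
    refine hu g f (by simpa using hg) hf ?_ hfx
    have h1 : Tendsto (fun t : ℝ => F (x + t • v) (x + t • v)) U (𝓝 (g x)) :=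
      (isBoundedBilinearMap_apply.continuous.tendsto (g, x)).comp
        (hUg.prodMk_nhds (hcont.mono_left hU))
    have h2 : Tendsto (fun t : ℝ => F (x + t • v) (x + t • v)) U (𝓝 ‖x‖) := by
      simp only [hFx]
      exact (hcont.mono_left hU).norm
    exact tendsto_nhds_unique h1 h2
  rw [hasLineDerivAt_iff_tendsto_slope_zero]
  have hv : Tendsto (fun t : ℝ => |F (x + t • v) v - f v|) (𝓝[≠] 0) (𝓝 0) := by
    have h1 : Tendsto (fun t : ℝ => F (x + t • v) v) (𝓝 0) (𝓝 (f v)) :=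
      ((ContinuousLinearMap.apply ℝ ℝ v).continuous.tendsto f).comp hlim
    have h2 := (h1.sub_const (f v)).abs
    simp only [sub_self, abs_zero] at h2
    exact h2.mono_left nhdsWithin_le_nhds
  rw [tendsto_iff_norm_sub_tendsto_zero]
  refine squeeze_zero' (Eventually.of_forall fun _ => norm_nonneg _) ?_ hv
  filter_upwards [self_mem_nhdsWithin] with t ht
  have ht0 : t ≠ 0 := ht
  -- The two support inequalities give `t * f v ≤ ‖x + t • v‖ - ‖x‖ ≤ t * F (x + t • v) v`, for
  -- either sign of `t`.
  have lo := apply_le_of_norm_le_one hf.le (x + t • v)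
  have hi := apply_le_of_norm_le_one (hF (x + t • v)).le x
  have he := hFx (x + t • v)
  simp only [map_add, map_smul, smul_eq_mul] at lo he
  have key : t⁻¹ • (‖x + t • v‖ - ‖x‖) - f v = t⁻¹ * (‖x + t • v‖ - ‖x‖ - t * f v) := by
    rw [smul_eq_mul]; field_simp
  have key2 : F (x + t • v) v - f v = t⁻¹ * (t * F (x + t • v) v - t * f v) := by
    field_simp
  rw [Real.norm_eq_abs, key, key2, abs_mul, abs_mul]
  refine mul_le_mul_of_nonneg_left ?_ (abs_nonneg _)
  rw [abs_of_nonneg (by linarith), abs_of_nonneg (by linarith)]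
  linarith

/-- A two-dimensional Gâteaux smooth space has no U-embedding into a space of continuous
functions. -/
theorem not_isUEmbedding_of_isGateauxSmooth (hX : Module.finrank ℝ X = 2)
    (hs : IsGateauxSmooth X) {K : Type*} [TopologicalSpace K] [CompactSpace K] [T2Space K]
    (T : X →ₗᵢ[ℝ] C(K, ℝ)) : ¬ IsUEmbedding T := by
  intro hT
  have : FiniteDimensional ℝ X := Module.finite_of_finrank_pos (by omega)
  have : Nontrivial X := Module.nontrivial_of_finrank_pos (R := ℝ) (by omega)
  let ev : K → StrongDual ℝ C(K, ℝ) := fun k => ContinuousMap.evalCLM ℝ k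
  have hev (k : K) : ‖ev k‖ ≤ 1 :=
    ContinuousLinearMap.opNorm_le_bound _ zero_le_one fun h => by
      simpa [ev] using h.norm_coe_le_norm k
  let A : Set (StrongDual ℝ X) := {f | ∃ k, ∀ x, T x k = f x}
  have hext {f : StrongDual ℝ X} {k : K} (hf : ‖f‖ = 1) (hk : ∀ x, T x k = f x) :
      IsHahnBanachExtension T f (ev k) := by
    have h1 : (ev k).comp T.toContinuousLinearMap = f := by ext x; exact hk x
    refine ⟨h1, le_antisymm (by simpa [hf] using hev k) ?_⟩
    rw [← h1]
    refine ContinuousLinearMap.opNorm_le_bound _ (norm_nonneg _) fun x => ?_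
    simpa [T.norm_map] using (ev k).le_opNorm (T x)
  -- `A` is the projection of a closed set along the compact factor `K`.
  have hA : IsClosed A := by
    have h1 : IsClosed {p : StrongDual ℝ X × K | ∀ x, T x p.2 = p.1 x} := by
      simp only [ofPred_forall]
      refine isClosed_iInter fun x => isClosed_eq ((T x).continuous.comp continuous_snd) ?_
      exact (ContinuousLinearMap.apply ℝ ℝ x).continuous.comp continuous_fst
    have h2 := isClosedMap_fst_of_compactSpace (X := StrongDual ℝ X) (Y := K) _ h1
    convert h2 using 1
    ext f
    simp [A]
  have hcover : sphere (0 : StrongDual ℝ X) 1 ⊆ A ∪ Neg.neg ⁻¹' A := by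
    intro f hf
    have hf1 : ‖f‖ = 1 := by simpa using hf
    obtain ⟨x, hx, hfx⟩ := exists_norm_eq_one_apply_eq_one f hf1
    obtain ⟨L, hL⟩ := hs x (by rintro rfl; simp at hx)
    have hfL := support_eq_of_hasLineDerivAt hL hf1.le (by rw [hfx, hx])
    have : ∃ k, 1 ≤ ‖T x k‖ := by
      by_contra! h
      have := (ContinuousMap.norm_lt_iff (T x) zero_lt_one).2 h
      rw [T.norm_map, hx] at this
      exact lt_irrefl _ this
    obtain ⟨k, hk⟩ := this
    let p : StrongDual ℝ X := (ev k).comp T.toContinuousLinearMap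
    have hp (y : X) : p y = T y k := rfl
    have hpn : ‖p‖ ≤ 1 := ContinuousLinearMap.opNorm_le_bound _ zero_le_one fun y => by
      rw [hp, one_mul]
      exact ((T y).norm_coe_le_norm k).trans (T.norm_map y).le
    have hkn : ‖T x k‖ ≤ 1 := ((T x).norm_coe_le_norm k).trans (by rw [T.norm_map, hx])
    rcases abs_cases (T x k) with ⟨h, -⟩ | ⟨h, -⟩ <;> rw [Real.norm_eq_abs, h] at hk hkn
    · left
      have h1 := support_eq_of_hasLineDerivAt hL hpn (by rw [hp, hx]; linarith)
      exact ⟨k, fun y => by rw [hfL, ← h1, hp]⟩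
    · right
      have h1 := support_eq_of_hasLineDerivAt hL (f := -p) (by rwa [norm_neg])
        (by rw [_root_.neg_apply, hp, hx]; linarith)
      exact ⟨k, fun y => by rw [hfL, ← h1, neg_neg, hp]⟩
  have hdisj {f : StrongDual ℝ X} (hf : ‖f‖ = 1) (h1 : f ∈ A) (h2 : -f ∈ A) : False := by
    obtain ⟨k, hk⟩ := h1
    obtain ⟨l, hl⟩ := h2
    obtain ⟨h3, h4⟩ := hext (by rwa [norm_neg]) hl
    have h5 : IsHahnBanachExtension T f (-ev l) :=
      ⟨by rw [ContinuousLinearMap.neg_comp, h3, neg_neg], by rw [norm_neg, h4, norm_neg]⟩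
    have h6 := (hT f hf).unique (hext hf hk) h5
    have h7 := DFunLike.congr_fun h6 (1 : C(K, ℝ))
    norm_num [ev] at h7
  have hrank : 1 < Module.rank ℝ (StrongDual ℝ X) := by
    have h : Module.finrank ℝ (StrongDual ℝ X) = 2 := by
      rw [← (LinearMap.toContinuousLinearMap (𝕜 := ℝ) (E := X) (F' := ℝ)).finrank_eq, ← hX]
      exact Subspace.dual_finrank_eq
    rw [← Module.finrank_eq_rank, h]
    norm_num
  have hconn := isPreconnected_closed_iff.1 (isPreconnected_sphere hrank 0 1) A (Neg.neg ⁻¹' A) hA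
    (hA.preimage continuous_neg) hcover
  obtain ⟨x, hx⟩ := exists_ne (0 : X)
  obtain ⟨f, hf, -⟩ := exists_dual_vector' ℝ x
  have hfs : f ∈ sphere (0 : StrongDual ℝ X) 1 := by simpa using hf
  have hnfs : -f ∈ sphere (0 : StrongDual ℝ X) 1 := by simpa using hf
  have hne : (sphere (0 : StrongDual ℝ X) 1 ∩ A).Nonempty ∧
      (sphere (0 : StrongDual ℝ X) 1 ∩ Neg.neg ⁻¹' A).Nonempty := by
    rcases hcover hfs with h | h
    · exact ⟨⟨f, hfs, h⟩, ⟨-f, hnfs, by simpa using h⟩⟩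
    · exact ⟨⟨-f, hnfs, h⟩, ⟨f, hfs, h⟩⟩
  obtain ⟨g, hg, hgA, hgA'⟩ := hconn hne.1 hne.2
  exact hdisj (by simpa using hg) hgA hgA'

end Smooth

/-! ### A criterion for U-embeddings through peak sets -/

section Criterion

variable {X K : Type*} [NormedAddCommGroup X] [NormedSpace ℝ X]
  [TopologicalSpace K] [CompactSpace K]

/-- A norm-one functional on `C(K, ℝ)` attaining its norm at `u` only sees the values on the set
where `|u| = 1`. -/
theorem apply_eq_zero_of_eqOn_peak {g : StrongDual ℝ C(K, ℝ)} (hg : ‖g‖ ≤ 1) {u h : C(K, ℝ)}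
    (hu : ‖u‖ ≤ 1) (hgu : g u = 1) (hh : ∀ k, |u k| = 1 → h k = 0) : g h = 0 := by
  have main : ∀ h : C(K, ℝ), (∀ k, |u k| = 1 → h k = 0) → g h ≤ 0 := by
    intro h hh
    refine le_of_forall_pos_le_add fun ε hε => ?_
    have hu1 (k : K) : |u k| ≤ 1 := (u.norm_coe_le_norm k).trans hu
    -- By compactness, `|u|` stays away from `1` where `|h|` is at least `ε`.
    have hr : ∃ r < 1, ∀ k, ε ≤ |h k| → |u k| ≤ r := by
      have hC : IsCompact {k | ε ≤ |h k|} :=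
        (isClosed_le continuous_const h.continuous.abs).isCompact
      rcases eq_empty_or_nonempty {k | ε ≤ |h k|} with h0 | h0
      · exact ⟨0, zero_lt_one, fun k hk => absurd (show k ∈ {k | ε ≤ |h k|} from hk) (by simp [h0])⟩
      · obtain ⟨k, hk, hmax⟩ := hC.exists_isMaxOn h0 u.continuous.abs.continuousOn
        refine ⟨|u k|, lt_of_le_of_ne (hu1 k) fun h1 => ?_, fun l hl => hmax hl⟩
        have : ε ≤ |h k| := hk
        rw [hh k h1, abs_zero] at this
        linarith
    obtain ⟨r, hr1, hr⟩ := hr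
    have hd : 0 < ‖h‖ + 1 := by positivity
    -- With this `t`, `|u| + t * |h|` is at most `1` where `|h| ≥ ε` and at most `1 + t * ε`
    -- elsewhere.
    set t := (1 - r) / (‖h‖ + 1) with ht
    have ht0 : 0 < t := div_pos (by linarith) hd
    have hth : t * (‖h‖ + 1) = 1 - r := by rw [ht]; field_simp
    have hnorm : ‖u + t • h‖ ≤ 1 + t * ε := by
      refine (ContinuousMap.norm_le _ (by positivity)).2 fun k => ?_
      have h1 : ‖(u + t • h) k‖ ≤ |u k| + t * |h k| := by
        simp only [ContinuousMap.add_apply, ContinuousMap.smul_apply, smul_eq_mul,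
          Real.norm_eq_abs]
        refine (abs_add_le _ _).trans ?_
        rw [abs_mul, abs_of_pos ht0]
      have hhk : |h k| ≤ ‖h‖ := h.norm_coe_le_norm k
      rcases le_or_gt ε |h k| with hk | hk
      · have := hr k hk
        nlinarith
      · have := hu1 k
        nlinarith
    have := apply_le_of_norm_le_one hg (u + t • h)
    rw [map_add, map_smul, hgu, smul_eq_mul] at this
    have : t * g h ≤ t * ε := by linarith
    rw [zero_add]
    exact le_of_mul_le_mul_left this ht0
  have h1 := main h hh
  have h2 := main (-h) fun k hk => by simp [hh k hk]
  rw [map_neg] at h2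
  linarith

/-- If for every unit vector `x` each continuous function is interpolated by `T` on the set where
`|T x| = 1`, then `T` is a U-embedding. -/
theorem isUEmbedding_of_interpolation [FiniteDimensional ℝ X] (T : X →ₗᵢ[ℝ] C(K, ℝ))
    (hT : ∀ x : X, ‖x‖ = 1 → ∀ h : C(K, ℝ), ∃ y : X, ∀ k, |T x k| = 1 → T y k = h k) :
    IsUEmbedding T := by
  intro f hf
  obtain ⟨g, hg⟩ := exists_isHahnBanachExtension T f
  refine ⟨g, hg, fun g' hg' => ?_⟩
  obtain ⟨x, hx, hfx⟩ := exists_norm_eq_one_apply_eq_one f hf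
  have hTx : ‖T x‖ ≤ 1 := by rw [T.norm_map, hx]
  have key {g : StrongDual ℝ C(K, ℝ)} (hg : IsHahnBanachExtension T f g) {h : C(K, ℝ)} {y : X}
      (hy : ∀ k, |T x k| = 1 → T y k = h k) : g h = f y := by
    have hap (z : X) : g (T z) = f z := by rw [← hg.1]; rfl
    have := apply_eq_zero_of_eqOn_peak (hg.2.trans hf).le hTx ((hap x).trans hfx) (h := h - T y)
      fun k hk => by simp [hy k hk]
    rw [map_sub, hap] at this
    linarith
  ext h
  obtain ⟨y, hy⟩ := hT x hx h
  rw [key hg hy, key hg' hy]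

end Criterion

/-! ### Extreme points of the dual ball of a plane -/

section Plane

variable {X : Type*} [NormedAddCommGroup X] [NormedSpace ℝ X]

/-- In a plane, a vector `x` with `f x = 1` is completed to a basis by a vector in the kernel
of `f`. -/
theorem exists_complement_in_ker (hX : Module.finrank ℝ X = 2) {x : X} {f : StrongDual ℝ X}
    (hfx : f x = 1) :
    ∃ y : X, f y = 0 ∧ ∀ g : StrongDual ℝ X, g x = 0 → g y = 0 → g = 0 := by
  have : FiniteDimensional ℝ X := Module.finite_of_finrank_pos (by omega)
  have hx : x ≠ 0 := by rintro rfl; simp at hfx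
  obtain ⟨y, hy⟩ := exists_linearIndependent_pair_of_one_lt_finrank (R := ℝ) (by omega) hx
  have hspan := hy.span_eq_top_of_card_eq_finrank' (by simp [hX])
  refine ⟨y - f y • x, by simp [hfx], fun g hgx hgy => ?_⟩
  have hgy' : g y = 0 := by simpa [hgx] using hgy
  have hle : Submodule.span ℝ (range ![x, y]) ≤ LinearMap.ker (g : X →ₗ[ℝ] ℝ) := by
    rw [Submodule.span_le]
    rintro _ ⟨i, rfl⟩
    fin_cases i <;> simpa
  rw [hspan] at hle
  ext z
  exact hle (Submodule.mem_top (x := z))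

/-- The extreme points of norm one of the dual unit ball. -/
def extremeSphere (X : Type*) [NormedAddCommGroup X] [NormedSpace ℝ X] :
    Set (StrongDual ℝ X) :=
  {f | f ∈ (closedBall (0 : StrongDual ℝ X) 1).extremePoints ℝ ∧ ‖f‖ = 1}

theorem neg_mem_extremeSphere {f : StrongDual ℝ X} (hf : f ∈ extremeSphere X) :
    -f ∈ extremeSphere X := by
  refine ⟨?_, by rw [norm_neg, hf.2]⟩
  have := image_extremePoints (𝕜 := ℝ) (LinearEquiv.neg ℝ (M := StrongDual ℝ X))
    (closedBall (0 : StrongDual ℝ X) 1)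
  have h2 : LinearEquiv.neg ℝ (M := StrongDual ℝ X) '' closedBall (0 : StrongDual ℝ X) 1 =
      closedBall 0 1 := by
    ext g
    simp only [mem_image, LinearEquiv.neg_apply, mem_closedBall_zero_iff]
    exact ⟨fun ⟨a, ha, hag⟩ => by rwa [← hag, norm_neg], fun h => ⟨-g, by rwa [norm_neg], neg_neg g⟩⟩
  rw [h2] at this
  rw [← this]
  exact ⟨f, hf.1, rfl⟩

/-- An extreme point is not the interior point of a segment in the ball. -/
theorem eq_zero_of_mem_extremeSphere {f w : StrongDual ℝ X} (hf : f ∈ extremeSphere X)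
    {s t : ℝ} (hs : 0 < s) (ht : 0 < t) (h1 : ‖f + s • w‖ ≤ 1) (h2 : ‖f - t • w‖ ≤ 1) : w = 0 := by
  have := (mem_extremePoints_iff_left.1 hf.1).2 (f + s • w) (by simpa using h1) (f - t • w)
    (by simpa using h2) ⟨t / (s + t), s / (s + t), by positivity, by positivity,
      by field_simp; ring, by
        have h3 : t / (s + t) * s = s / (s + t) * t := by ring
        have h4 : t / (s + t) + s / (s + t) = 1 := by field_simp; ring
        calc _ = (t / (s + t) + s / (s + t)) • f + (t / (s + t) * s - s / (s + t) * t) • w := by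
              module
          _ = f := by rw [h3, h4]; simp⟩
  have h5 : s • w = 0 := by simpa using this
  exact (smul_eq_zero.1 h5).resolve_left hs.ne'

/-- Every vector is normed by an extreme point of the dual unit ball. -/
theorem exists_mem_extremeSphere_apply_eq_norm [FiniteDimensional ℝ X] {x : X} (hx : x ≠ 0) :
    ∃ f ∈ extremeSphere X, f x = ‖x‖ := by
  let B := closedBall (0 : StrongDual ℝ X) 1
  have hB : IsCompact B := isCompact_closedBall _ _
  let l : StrongDual ℝ (StrongDual ℝ X) := ContinuousLinearMap.apply ℝ ℝ x
  -- An extreme point of the exposed face cut out by evaluation at `x` is extreme in the whole ball.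
  have hexp : IsExposed ℝ B (l.toExposed B) := ContinuousLinearMap.toExposed.isExposed
  obtain ⟨p, hp, hpx⟩ := exists_dual_vector'' ℝ x
  simp only [RCLike.ofReal_real_eq_id, id] at hpx
  have hne : (l.toExposed B).Nonempty := by
    refine ⟨p, by simpa [B] using hp, fun q hq => ?_⟩
    change q x ≤ p x
    rw [hpx]
    exact apply_le_of_norm_le_one (by simpa [B] using hq) x
  obtain ⟨f, hf⟩ := (hexp.isCompact hB).extremePoints_nonempty hne
  have hfe := hexp.isExtreme.extremePoints_subset_extremePoints hf
  have hfB : ‖f‖ ≤ 1 := by simpa [B] using extremePoints_subset hfe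
  have hfx : f x = ‖x‖ := by
    refine le_antisymm (apply_le_of_norm_le_one hfB x) ?_
    rw [← hpx]
    exact (extremePoints_subset hf).2 p (by simpa [B] using hp)
  refine ⟨f, ⟨hfe, le_antisymm hfB ?_⟩, hfx⟩
  have h1 := f.le_opNorm x
  rw [hfx, norm_norm] at h1
  exact le_of_mul_le_mul_right (by simpa using h1) (norm_pos_iff.2 hx)

/-- In a plane the extreme points of the dual unit ball form a closed set. -/
theorem isClosed_extremeSphere (hX : Module.finrank ℝ X = 2) : IsClosed (extremeSphere X) := by
  have : FiniteDimensional ℝ X := Module.finite_of_finrank_pos (by omega)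
  rw [isClosed_iff_frequently]
  intro f hfreq
  have hf : ‖f‖ = 1 := by
    have : f ∈ closure {g : StrongDual ℝ X | ‖g‖ = 1} :=
      mem_closure_iff_frequently.2 (hfreq.mono fun g hg => hg.2)
    rwa [(isClosed_eq continuous_norm continuous_const).closure_eq] at this
  refine ⟨mem_extremePoints_iff_left.2 ⟨by simpa using hf.le, ?_⟩, hf⟩
  rintro c hc d hd ⟨a, b, ha, hb, hab, rfl⟩
  set f := a • c + b • d with hfdef
  have hc1 : ‖c‖ ≤ 1 := by simpa using hc
  have hd1 : ‖d‖ ≤ 1 := by simpa using hd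
  set w := d - c with hw
  have hball {γ : ℝ} (h1 : -b ≤ γ) (h2 : γ ≤ a) : ‖f + γ • w‖ ≤ 1 := by
    have h3 : f + γ • w = (a - γ) • c + (b + γ) • d := by rw [hfdef, hw]; module
    have := convex_closedBall (0 : StrongDual ℝ X) 1 hc hd
      (show 0 ≤ a - γ by linarith) (show 0 ≤ b + γ by linarith) (by linarith only [hab])
    rw [← h3] at this
    simpa using this
  suffices w = 0 by
    have h1 : d = c := sub_eq_zero.1 this
    rw [hfdef, h1, ← add_smul, hab, one_smul]
  by_contra hw0
  obtain ⟨x, hx, hfx⟩ := exists_norm_eq_one_apply_eq_one f hf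
  obtain ⟨y, hfy, hy⟩ := exists_complement_in_ker hX hfx
  have hcx := apply_le_of_norm_le_one hc1 x
  have hdx := apply_le_of_norm_le_one hd1 x
  have hwx : w x = 0 := by
    have h1 : a * c x + b * d x = 1 := hfx
    have h2 : w x = d x - c x := rfl
    rw [hx] at hcx hdx
    have : c x = 1 := by nlinarith
    have : d x = 1 := by nlinarith
    linarith
  have hwy : w y ≠ 0 := fun h => hw0 (hy w hwx h)
  -- An extreme `g` near `f` is `α • f + β • w`, with `α > 1 / 2` and `|β| < η`. The factor `1 / 2`
  -- keeps both `β / α` and `β ± η` in `[-b, a]`, the range allowed by `hball`. Then `‖g‖ = 1`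
  -- forces `α = 1`, and `g` is interior to the segment.
  set η := min a b / 2 with hη
  have hη0 : 0 < η := by positivity
  have hηa : 2 * η ≤ a := by rw [hη]; linarith [min_le_left a b]
  have hηb : 2 * η ≤ b := by rw [hη]; linarith [min_le_right a b]
  have hev1 : ∀ᶠ g : StrongDual ℝ X in 𝓝 f, 1 / 2 < g x :=
    (ContinuousLinearMap.apply ℝ ℝ x).continuous.continuousAt.eventually_const_lt
      (show (1 / 2 : ℝ) < f x by rw [hfx]; norm_num)
  have hev2 : ∀ᶠ g : StrongDual ℝ X in 𝓝 f, |g y / w y| < η := by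
    have : Continuous fun g : StrongDual ℝ X => |g y / w y| :=
      ((ContinuousLinearMap.apply ℝ ℝ y).continuous.div_const _).abs
    exact this.continuousAt.eventually_lt_const (by simpa [hfy] using hη0)
  obtain ⟨g, hg, hgx, hgy⟩ := (hfreq.and_eventually (hev1.and hev2)).exists
  set α := g x
  set β := g y / w y
  have hgdec : g = α • f + β • w := by
    refine sub_eq_zero.1 (hy _ ?_ ?_)
    · simp [hfx, hwx, α]
    · simp [hfy, β, hwy]
  have hα0 : 0 < α := by linarith
  have hβ := abs_lt.1 hgy
  have hα : α = 1 := by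
    refine le_antisymm ?_ ?_
    · have := apply_le_of_norm_le_one hg.2.le x
      rwa [hx] at this
    · have h1 : g = α • (f + (β / α) • w) := by
        have h0 : α * (β / α) = β := by field_simp
        rw [_root_.smul_add α f, smul_smul, h0, hgdec]
      have h2 : ‖f + (β / α) • w‖ ≤ 1 := by
        refine hball ?_ ?_
        · rw [le_div_iff₀ hα0]; nlinarith
        · rw [div_le_iff₀ hα0]; nlinarith
      have h3 := hg.2
      rw [h1, norm_smul, Real.norm_eq_abs, abs_of_pos hα0] at h3
      nlinarith
  refine hw0 (eq_zero_of_mem_extremeSphere hg hη0 hη0 ?_ ?_)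
  · have : g + η • w = f + (β + η) • w := by rw [hgdec, hα]; module
    rw [this]
    exact hball (by linarith) (by linarith)
  · have : g - η • w = f + (β - η) • w := by rw [hgdec, hα]; module
    rw [this]
    exact hball (by linarith) (by linarith)

/-- On a line supporting the dual unit ball of a plane, no extreme point lies strictly between two
points of the ball. -/
theorem not_between_of_mem_extremeSphere {x y : X}
    (hy : ∀ g : StrongDual ℝ X, g x = 0 → g y = 0 → g = 0) {f₁ f₂ f₃ : StrongDual ℝ X}
    (h₁ : ‖f₁‖ ≤ 1) (h₂ : f₂ ∈ extremeSphere X) (h₃ : ‖f₃‖ ≤ 1)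
    (hx₁ : f₁ x = 1) (hx₂ : f₂ x = 1) (hx₃ : f₃ x = 1) (h₁₂ : f₁ y < f₂ y) (h₂₃ : f₂ y < f₃ y) :
    False := by
  have hd : f₃ y - f₁ y ≠ 0 := by linarith
  have key (c : StrongDual ℝ X) (hc : c x = 1) :
      f₂ + ((c y - f₂ y) / (f₃ y - f₁ y)) • (f₃ - f₁) = c := by
    refine sub_eq_zero.1 (hy _ ?_ ?_)
    · simp [hx₁, hx₂, hx₃, hc]
    · simp only [_root_.sub_apply, _root_.add_apply, _root_.smul_apply, smul_eq_mul]
      field_simp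
      ring
  have hw := eq_zero_of_mem_extremeSphere h₂ (w := f₃ - f₁)
    (s := (f₃ y - f₂ y) / (f₃ y - f₁ y)) (t := (f₂ y - f₁ y) / (f₃ y - f₁ y))
    (div_pos (by linarith) (by linarith)) (div_pos (by linarith) (by linarith))
    (by rwa [key f₃ hx₃]) (by
      have h : f₂ - ((f₂ y - f₁ y) / (f₃ y - f₁ y)) • (f₃ - f₁) = f₁ := by
        refine Eq.trans ?_ (key f₁ hx₁)
        module
      rwa [h])
  have := DFunLike.congr_fun hw y
  simp only [_root_.sub_apply, _root_.zero_apply] at this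
  exact hd this

/-- A supporting line of the dual unit ball of a plane contains at most two extreme points. -/
theorem eq_or_eq_of_mem_extremeSphere {x y : X}
    (hy : ∀ g : StrongDual ℝ X, g x = 0 → g y = 0 → g = 0) {f₁ f₂ f₃ : StrongDual ℝ X}
    (h₁ : f₁ ∈ extremeSphere X) (h₂ : f₂ ∈ extremeSphere X) (h₃ : f₃ ∈ extremeSphere X)
    (hx₁ : f₁ x = 1) (hx₂ : f₂ x = 1) (hx₃ : f₃ x = 1) (hne : f₁ ≠ f₂) :
    f₃ = f₁ ∨ f₃ = f₂ := by
  have inj {f g : StrongDual ℝ X} (hf : f x = 1) (hg : g x = 1) (h : f ≠ g) : f y ≠ g y :=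
    fun h' => h (sub_eq_zero.1 (hy _ (by simp [hf, hg]) (by simp [h'])))
  by_contra! h
  have h12 := inj hx₁ hx₂ hne
  have h31 := inj hx₃ hx₁ h.1
  have h32 := inj hx₃ hx₂ h.2
  have nb {a b c : StrongDual ℝ X} (ha : a ∈ extremeSphere X) (hb : b ∈ extremeSphere X)
      (hc : c ∈ extremeSphere X) (hxa : a x = 1) (hxb : b x = 1) (hxc : c x = 1)
      (hab : a y < b y) (hbc : b y < c y) : False :=
    not_between_of_mem_extremeSphere hy ha.2.le hb hc.2.le hxa hxb hxc hab hbc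
  -- Two of the eight sign patterns are cyclic, hence impossible; in the others one value lies
  -- strictly between the other two.
  rcases lt_or_gt_of_ne h12 with a | a <;> rcases lt_or_gt_of_ne h31 with b | b <;>
    rcases lt_or_gt_of_ne h32 with c | c
  · exact nb h₃ h₁ h₂ hx₃ hx₁ hx₂ b a
  · linarith
  · exact nb h₁ h₃ h₂ hx₁ hx₃ hx₂ b c
  · exact nb h₁ h₂ h₃ hx₁ hx₂ hx₃ a c
  · exact nb h₃ h₂ h₁ hx₃ hx₂ hx₁ c a
  · exact nb h₂ h₃ h₁ hx₂ hx₃ hx₁ c b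
  · linarith
  · exact nb h₂ h₁ h₃ hx₂ hx₁ hx₃ a b

end Plane

/-! ### The embedding built from half of the extreme points -/

section Construction

variable {X : Type*} [NormedAddCommGroup X] [NormedSpace ℝ X]

/-- If a plane is not Gâteaux smooth, some line through the origin of its dual misses all extreme
points of the dual unit ball. -/
theorem exists_forall_mem_extremeSphere_apply_ne_zero (hX : Module.finrank ℝ X = 2)
    (hs : ¬ IsGateauxSmooth X) : ∃ u : X, ∀ e ∈ extremeSphere X, e u ≠ 0 := by
  have : FiniteDimensional ℝ X := Module.finite_of_finrank_pos (by omega)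
  have : Nontrivial X := Module.nontrivial_of_finrank_pos (R := ℝ) (by omega)
  simp only [IsGateauxSmooth, not_forall] at hs
  obtain ⟨x, hx, hsx⟩ := hs
  have : ∃ f g : StrongDual ℝ X, ‖f‖ = 1 ∧ ‖g‖ = 1 ∧ f x = ‖x‖ ∧ g x = ‖x‖ ∧ f ≠ g := by
    by_contra! h
    exact hsx (gateauxDifferentiableAt_of_unique_support h)
  obtain ⟨f, g, hf, hg, hfx, hgx, hfg⟩ := this
  set m : StrongDual ℝ X := (1 / 2 : ℝ) • f + (1 / 2 : ℝ) • g with hm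
  set w : StrongDual ℝ X := (1 / 2 : ℝ) • f - (1 / 2 : ℝ) • g with hw
  have hxn : ‖x‖ ≠ 0 := norm_ne_zero_iff.2 hx
  have hmx : m (‖x‖⁻¹ • x) = 1 := by
    simp only [hm, _root_.add_apply, _root_.smul_apply, map_smul, hfx, hgx, smul_eq_mul]
    field_simp
    norm_num
  have hmE : m ∉ extremeSphere X := fun h => by
    have h0 := eq_zero_of_mem_extremeSphere h (w := w) one_pos one_pos
      (by rw [show m + (1 : ℝ) • w = f by rw [hm, hw]; module]; exact hf.le)
      (by rw [show m - (1 : ℝ) • w = g by rw [hm, hw]; module]; exact hg.le)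
    refine hfg (sub_eq_zero.1 ?_)
    calc f - g = (2 : ℝ) • w := by rw [hw]; module
      _ = 0 := by rw [h0, smul_zero]
  have hm1 : ‖m‖ = 1 := by
    refine le_antisymm ?_ ?_
    · refine (norm_add_le _ _).trans ?_
      rw [norm_smul, norm_smul, hf, hg]
      norm_num
    · have := m.le_opNorm (‖x‖⁻¹ • x)
      rwa [hmx, norm_one, norm_smul, norm_inv, norm_norm, inv_mul_cancel₀ hxn, mul_one] at this
  -- The functionals vanishing at `u` are the multiples of `m`, so an extreme one of norm one would
  -- be `±m`.
  obtain ⟨u, hmu, hu⟩ := exists_complement_in_ker hX hmx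
  refine ⟨u, fun e he heu => ?_⟩
  have hem : e = e (‖x‖⁻¹ • x) • m := by
    refine sub_eq_zero.1 (hu _ ?_ ?_)
    · rw [_root_.sub_apply, _root_.smul_apply, hmx, smul_eq_mul, mul_one, sub_self]
    · rw [_root_.sub_apply, _root_.smul_apply, hmu, heu, smul_zero, sub_self]
  generalize e (‖x‖⁻¹ • x) = c at hem
  have hc : |c| = 1 := by
    have := he.2
    rwa [hem, norm_smul, hm1, mul_one] at this
  rcases (abs_eq zero_le_one).1 hc with h | h <;> rw [h] at hem
  · rw [one_smul] at hem
    exact hmE (hem ▸ he)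
  · have hem' : e = -m := by rw [hem]; module
    have := neg_mem_extremeSphere he
    rw [hem', neg_neg] at this
    exact hmE this

/-- If `K` parametrizes the extreme points of the dual unit ball of a plane lying in an open half
plane whose boundary contains no extreme point, evaluation is a U-embedding into `C(K, ℝ)`. -/
theorem exists_isUEmbedding_of_parametrization (hX : Module.finrank ℝ X = 2) {u : X}
    (hu : ∀ e ∈ extremeSphere X, e u ≠ 0) {K : Type*} [TopologicalSpace K] [CompactSpace K]
    {φ : K → StrongDual ℝ X} (hφ : Continuous φ) (hinj : Function.Injective φ)
    (hrange : range φ = extremeSphere X ∩ {f | 0 ≤ f u}) :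
    ∃ T : X →ₗᵢ[ℝ] C(K, ℝ), IsUEmbedding T := by
  have : FiniteDimensional ℝ X := Module.finite_of_finrank_pos (by omega)
  have hmem (k : K) : φ k ∈ extremeSphere X ∧ 0 ≤ φ k u := by
    have h : φ k ∈ range φ := mem_range_self k
    rwa [hrange] at h
  have hpos (k : K) : 0 < φ k u := lt_of_le_of_ne (hmem k).2 (hu _ (hmem k).1).symm
  let T₀ : X →ₗ[ℝ] C(K, ℝ) :=
    { toFun := fun x => ⟨fun k => φ k x, (ContinuousLinearMap.apply ℝ ℝ x).continuous.comp hφ⟩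
      map_add' := fun x y => by ext k; exact map_add (φ k) x y
      map_smul' := fun c x => by ext k; exact map_smul (φ k) c x }
  have hT₀ (x : X) (k : K) : T₀ x k = φ k x := rfl
  have hnorm (x : X) : ‖T₀ x‖ = ‖x‖ := by
    refine le_antisymm ((ContinuousMap.norm_le _ (norm_nonneg x)).2 fun k => ?_) ?_
    · have := (φ k).le_opNorm x
      rwa [(hmem k).1.2, one_mul] at this
    · rcases eq_or_ne x 0 with rfl | hx
      · simp
      obtain ⟨f, hf, hfx⟩ := exists_mem_extremeSphere_apply_eq_norm hx
      rcases le_total 0 (f u) with h | h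
      · obtain ⟨k, hk⟩ : f ∈ range φ := by rw [hrange]; exact ⟨hf, h⟩
        rw [← hfx, ← hk]
        exact (le_abs_self _).trans ((T₀ x).norm_coe_le_norm k)
      · obtain ⟨k, hk⟩ : -f ∈ range φ := by
          rw [hrange]
          exact ⟨neg_mem_extremeSphere hf, by simpa using h⟩
        rw [← hfx, ← neg_neg f, ← hk]
        exact (neg_le_abs _).trans ((T₀ x).norm_coe_le_norm k)
  refine ⟨⟨T₀, hnorm⟩, isUEmbedding_of_interpolation _ fun x hx h => ?_⟩
  change ∃ y, ∀ k, |φ k x| = 1 → φ k y = h k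
  by_cases hsub : ∃ k l, |φ k x| = 1 ∧ |φ l x| = 1 ∧ k ≠ l
  swap
  · by_cases hE : ∃ k, |φ k x| = 1
    · obtain ⟨k, hk⟩ := hE
      refine ⟨(h k / φ k x) • x, fun l hl => ?_⟩
      have : l = k := by
        by_contra hne
        exact hsub ⟨l, k, hl, hk, hne⟩
      have hk0 : φ k x ≠ 0 := fun h0 => by simp [h0] at hk
      rw [this, map_smul, smul_eq_mul]
      field_simp
    · exact ⟨0, fun k hk => absurd ⟨k, hk⟩ hE⟩
  obtain ⟨k, l, hk, hl, hkl⟩ := hsub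
  -- The sign `φ j x` moves each peak point onto the supporting line of functionals equal to `1` at
  -- `x`, which holds at most two extreme points. Positivity at `u` excludes antipodal pairs, so no
  -- two peak points are identified.
  let σ : K → StrongDual ℝ X := fun j => φ j x • φ j
  have hσx {j : K} (hj : |φ j x| = 1) : σ j x = 1 := by
    change φ j x * φ j x = 1
    rw [← abs_mul_abs_self, hj, one_mul]
  have hσE {j : K} (hj : |φ j x| = 1) : σ j ∈ extremeSphere X := by
    rcases (abs_eq zero_le_one).1 hj with h1 | h1 <;> simp only [σ, h1]
    · simpa using (hmem j).1
    · rw [show (-1 : ℝ) • φ j = -φ j by module]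
      exact neg_mem_extremeSphere (hmem j).1
  have hσinj {i j : K} (hi : |φ i x| = 1) (hj : |φ j x| = 1) (h : σ i = σ j) : i = j := by
    have hue : φ i x * φ i u = φ j x * φ j u := DFunLike.congr_fun h u
    have hi0 := hpos i
    have hj0 := hpos j
    refine hinj ?_
    rcases (abs_eq zero_le_one).1 hi with h1 | h1 <;>
      rcases (abs_eq zero_le_one).1 hj with h2 | h2 <;> rw [h1, h2] at hue
    · simpa [σ, h1, h2] using h
    · linarith
    · linarith
    · simpa [σ, h1, h2] using h
  obtain ⟨y, -, hy⟩ := exists_complement_in_ker hX (hσx hk)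
  have hall {j : K} (hj : |φ j x| = 1) : j = k ∨ j = l :=
    (eq_or_eq_of_mem_extremeSphere hy (hσE hk) (hσE hl) (hσE hj) (hσx hk) (hσx hl) (hσx hj)
      fun h => hkl (hσinj hk hl h)).imp (hσinj hj hk) (hσinj hj hl)
  have hne : σ k y - σ l y ≠ 0 := fun h0 =>
    hkl (hσinj hk hl (sub_eq_zero.1 (hy _ (by simp [hσx hk, hσx hl]) (by simpa using h0))))
  have hred {j : K} (hj : |φ j x| = 1) {z : X} (hz : σ j z = φ j x * h j) : φ j z = h j := by
    have hj0 : φ j x ≠ 0 := fun h0 => by simp [h0] at hj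
    exact mul_left_cancel₀ hj0 hz
  -- `a` and `b` solve `a + b * σ j y = φ j x * h j` for `j = k, l`.
  let b := (φ k x * h k - φ l x * h l) / (σ k y - σ l y)
  let a := φ k x * h k - b * σ k y
  have hb : b * (σ k y - σ l y) = φ k x * h k - φ l x * h l := div_mul_cancel₀ _ hne
  refine ⟨a • x + b • y, fun j hj => hred hj ?_⟩
  rw [map_add, map_smul, map_smul, hσx hj, smul_eq_mul, smul_eq_mul]
  rcases hall hj with rfl | rfl
  · ring
  · linarith

end Construction

theorem mainTheorem5 (X : Type u) [NormedAddCommGroup X] [NormedSpace ℝ X]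
    (hX : Module.finrank ℝ X = 2) :
    (∃ (K : Type v) (_ : TopologicalSpace K) (_ : CompactSpace K) (_ : T2Space K)
        (T : X →ₗᵢ[ℝ] C(K, ℝ)), IsUEmbedding T) ↔
      ¬ IsGateauxSmooth X := by
  constructor
  · rintro ⟨K, _, _, _, T, hT⟩ hs
    exact not_isUEmbedding_of_isGateauxSmooth hX hs T hT
  · intro hs
    have : FiniteDimensional ℝ X := Module.finite_of_finrank_pos (by omega)
    obtain ⟨u, hu⟩ := exists_forall_mem_extremeSphere_apply_ne_zero hX hs
    let S : Set (StrongDual ℝ X) := extremeSphere X ∩ {f | 0 ≤ f u}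
    have hS : IsCompact S := by
      refine (isCompact_sphere (0 : StrongDual ℝ X) 1).of_isClosed_subset
        ((isClosed_extremeSphere hX).inter (isClosed_le continuous_const
          (ContinuousLinearMap.apply ℝ ℝ u).continuous)) fun f hf => ?_
      simpa using hf.1.2
    -- The dual lives in universe `u`; coordinates move `S` to universe `0`, from which it lifts to
    -- the required `v`.
    let L : StrongDual ℝ X ≃L[ℝ] (Fin (Module.finrank ℝ (StrongDual ℝ X)) → ℝ) :=
      ContinuousLinearEquiv.ofFinrankEq (by simp)
    have : CompactSpace (L '' S) := isCompact_iff_compactSpace.1 (hS.image L.continuous)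
    obtain ⟨T, hT⟩ := exists_isUEmbedding_of_parametrization hX hu (K := ULift.{v} (L '' S))
      (φ := fun k => L.symm k.down) (by fun_prop)
      (fun k l h => ULift.down_injective (Subtype.ext (L.symm.injective h))) (by
        ext f
        constructor
        · rintro ⟨⟨_, g, hg, rfl⟩, rfl⟩
          change L.symm (L g) ∈ S
          rwa [L.symm_apply_apply]
        · exact fun hf => ⟨⟨⟨L f, f, hf, rfl⟩⟩, by simp⟩)
    exact ⟨ULift.{v} (L '' S), inferInstance, inferInstance, inferInstance, T, hT⟩
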